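/- Let $k$ and $n$ be positive integers and let $k=p_1^{\alpha_1}\cdots p_r^{\alpha_r}$ be the prime factorization of $k$ (with $p_1,\dots,p_r$ distinct primes, each $\alpha_i\ge 1$, and $r=0$ if $k=1$). Write $[A,B]=AB-BA$ and $\mathbb{N}p_1+\cdots+\mathbb{N}p_r=\{c_1p_1+\cdots+c_rp_r : c_1,\dots,c_r\in\mathbb{Z}_{\ge 0}\}$, which is $\{0\}$ if $r=0$. Then there exist matrices $A,B\in M_n(\mathbb{C})$ with $[A,B]^k=\mathrm{Id}_n$ if and only if $n\in\mathbb{N}p_1+\cdots+\mathbb{N}p_r$. Moreover, $n\in\mathbb{N}p_1+\cdots+\mathbb{N}p_r$ if and only if $n$ lies in the weight set $W(k)$, the set of all positive integers $m$ for which there exist $\eta_1,\dots,\eta_m\in\mathbb{C}$, not necessarily distinct, with $\eta_i^k=1$ for all $i$ and $\eta_1+\cdots+\eta_m=0$. -/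

import Mathlib

/-- The set `M_{k,n}` of pairs `(A, B)` of complex `n × n` matrices with `[A, B] ^ k = Id_n`,
where `[A, B] = A * B - B * A` is the commutator. -/
def commutatorPowOneSet (k n : ℕ) :
    Set (Matrix (Fin n) (Fin n) ℂ × Matrix (Fin n) (Fin n) ℂ) :=
  {P | (P.1 * P.2 - P.2 * P.1) ^ k = 1}

/-- The set `ℕ p₁ + ⋯ + ℕ pᵣ`, where `p₁, …, pᵣ` are the distinct prime factors of `k`
(for `k = 1` it is the empty sum `{0}`). -/
def primeFactorCombinations (k : ℕ) : Set ℕ :=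
  {n | ∃ c : ℕ → ℕ, n = ∑ p ∈ k.primeFactors, c p * p}

/-- The weight set `W(m)`: the positive integers `n` for which some `n` complex `m`-th roots of
unity, repetitions allowed, add up to zero. -/
def weightSet (m : ℕ) : Set ℕ :=
  {n | 0 < n ∧ ∃ η : Fin n → ℂ, (∀ i, η i ^ m = 1) ∧ ∑ i, η i = 0}

/-! The eigenvalues of `[A, B]` are `k`-th roots of unity whose sum is the trace, `0`; conversely, a
trace-zero diagonal matrix is a commutator. What remains is the Lam–Leung theorem on lengths of
vanishing sums of roots of unity.

Let `P < Q` be the two least primes dividing `k`. From `(P - 1) * (Q - 1)` on, every integer is a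
combination of `P` and `Q`. Below that bound, primes `p` are stripped off `k` one at a time: a sum
of `(p * l)`-th roots of unity is `∑ θ ^ i * X i` with each `X i` a sum of `l`-th roots, and
cyclotomic degrees leave no relation among the `θ ^ i`, or only `∑ θ ^ i = 0`. The second case
yields equal sums rather than vanishing ones, so the induction in `exists_fst_eq_add_of_snd_eq`
compares two sums under a weighted length bound that survives each step. -/

open IntermediateField in
/-- Few powers of `θ` are linearly independent over `ℚ(ζ')` once `ℚ(ζ', θ)` contains a primitive
root of unity of large order. -/
theorem linearIndependent_pow_of_totient_le {k k' d : ℕ} {ζ' ζ θ : ℂ} (hk' : 0 < k') (hk : 0 < k)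
    (hζ' : IsPrimitiveRoot ζ' k') (hζ : IsPrimitiveRoot ζ k) (hθ : IsIntegral ℚ θ)
    (hmem : ζ ∈ ℚ⟮ζ'⟯⟮θ⟯) (hd : d * k'.totient ≤ k.totient) :
    LinearIndependent ℚ⟮ζ'⟯ fun i : Fin d => θ ^ (i : ℕ) := by
  have hfin : ∀ {m : ℕ} {ξ : ℂ}, 0 < m → IsPrimitiveRoot ξ m →
      Module.finrank ℚ ℚ⟮ξ⟯ = m.totient := by
    intro m ξ hm hξ
    rw [adjoin.finrank (hξ.isIntegral hm).tower_top,
      ← Polynomial.cyclotomic_eq_minpoly_rat hξ hm, Polynomial.natDegree_cyclotomic]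
  have hθ' : IsIntegral ℚ⟮ζ'⟯ θ := hθ.tower_top
  have : FiniteDimensional ℚ ℚ⟮ζ'⟯ := adjoin.finiteDimensional (hζ'.isIntegral hk').tower_top
  have : FiniteDimensional ℚ⟮ζ'⟯ ℚ⟮ζ'⟯⟮θ⟯ := adjoin.finiteDimensional hθ'
  have : FiniteDimensional ℚ (restrictScalars ℚ ℚ⟮ζ'⟯⟮θ⟯) :=
    FiniteDimensional.trans ℚ ℚ⟮ζ'⟯ ℚ⟮ζ'⟯⟮θ⟯
  -- Degrees over `ℚ` give `φ(k) ≤ φ(k') * [ℚ(ζ', θ) : ℚ(ζ')]`, so `θ` has degree at least `d` over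
  -- `ℚ(ζ')`.
  have hle : ℚ⟮ζ⟯ ≤ restrictScalars ℚ ℚ⟮ζ'⟯⟮θ⟯ :=
    adjoin_simple_le_iff.mpr hmem
  have h1 := finrank_le_of_le_right hle
  have h2 : Module.finrank ℚ ℚ⟮ζ'⟯ * Module.finrank ℚ⟮ζ'⟯ ℚ⟮ζ'⟯⟮θ⟯ =
      Module.finrank ℚ (restrictScalars ℚ ℚ⟮ζ'⟯⟮θ⟯) :=
    Module.finrank_mul_finrank ℚ ℚ⟮ζ'⟯ ℚ⟮ζ'⟯⟮θ⟯
  rw [hfin hk hζ, ← h2, hfin hk' hζ', adjoin.finrank hθ', mul_comm] at h1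
  have h3 : d ≤ (minpoly ℚ⟮ζ'⟯ θ).natDegree :=
    Nat.le_of_mul_le_mul_right (hd.trans h1) (Nat.totient_pos.mpr hk')
  exact (linearIndependent_pow (K := ℚ⟮ζ'⟯) θ).comp (Fin.castLE h3) (Fin.castLE_injective h3)

/-! ### Sums of roots of unity, with their lengths -/

/-- The pairs `(a, α)` such that `α` is a sum of `a` complex `k`-th roots of unity. -/
def rootSums (k : ℕ) : AddSubmonoid (ℕ × ℂ) :=
  AddSubmonoid.closure {q | q.1 = 1 ∧ q.2 ^ k = 1}

theorem root_mem_rootSums {k : ℕ} {z : ℂ} (hz : z ^ k = 1) : ((1, z) : ℕ × ℂ) ∈ rootSums k :=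
  AddSubmonoid.subset_closure ⟨rfl, hz⟩

theorem rootSums_induction {k : ℕ} {motive : (x : ℕ × ℂ) → x ∈ rootSums k → Prop}
    (root : ∀ (z : ℂ) (hz : z ^ k = 1), motive (1, z) (root_mem_rootSums hz))
    (zero : motive 0 (zero_mem _))
    (add : ∀ x y hx hy, motive x hx → motive y hy → motive (x + y) (add_mem hx hy)) {x : ℕ × ℂ}
    (hx : x ∈ rootSums k) : motive x hx := by
  refine AddSubmonoid.closure_induction (motive := motive) ?_ zero add hx
  rintro ⟨a, z⟩ ⟨ha, hz⟩
  obtain rfl : a = 1 := ha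
  exact root z hz

theorem sum_mem_rootSums {k : ℕ} {ι : Type*} (s : Finset ι) (η : ι → ℂ)
    (h : ∀ i ∈ s, η i ^ k = 1) : ((s.card, ∑ i ∈ s, η i) : ℕ × ℂ) ∈ rootSums k := by
  have := AddSubmonoid.sum_mem (rootSums k) (t := s) (f := fun i => ((1, η i) : ℕ × ℂ))
    fun i hi => root_mem_rootSums (h i hi)
  convert this using 1
  ext <;> simp [Prod.fst_sum, Prod.snd_sum]

theorem exists_fin_of_mem_rootSums {k : ℕ} {x : ℕ × ℂ} (hx : x ∈ rootSums k) :
    ∃ η : Fin x.1 → ℂ, (∀ i, η i ^ k = 1) ∧ ∑ i, η i = x.2 := by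
  induction hx using rootSums_induction with
  | root z hz => exact ⟨fun _ => z, fun _ => hz, by simp⟩
  | zero => exact ⟨fun _ => 1, fun _ => one_pow k, by simp⟩
  | add x y _ _ hx hy =>
    obtain ⟨η, hη, hs⟩ := hx
    obtain ⟨ξ, hξ, ht⟩ := hy
    refine ⟨Fin.append η ξ, fun i => ?_, ?_⟩
    · refine Fin.addCases (fun i => ?_) (fun i => ?_) i
      · simpa using hη i
      · simpa using hξ i
    · rw [Prod.snd_add, ← hs, ← ht]
      exact (Fin.sum_univ_add _).trans (by simp)

theorem snd_eq_zero_of_mem_rootSums {k : ℕ} {x : ℕ × ℂ} (hx : x ∈ rootSums k) (h : x.1 = 0) :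
    x.2 = 0 := by
  induction hx using rootSums_induction with
  | root z hz => simp at h
  | zero => rfl
  | add x y _ _ hx hy =>
    simp only [Prod.fst_add, Nat.add_eq_zero_iff] at h
    simp [hx h.1, hy h.2]

theorem snd_eq_fst_of_mem_rootSums_one {x : ℕ × ℂ} (hx : x ∈ rootSums 1) : x.2 = x.1 := by
  induction hx using rootSums_induction with
  | root z hz => simpa using hz
  | zero => simp
  | add x y _ _ hx hy => simp [hx, hy]

open IntermediateField in
theorem snd_mem_adjoin_of_mem_rootSums {k : ℕ} (hk : 0 < k) {ζ : ℂ} (hζ : IsPrimitiveRoot ζ k)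
    {x : ℕ × ℂ} (hx : x ∈ rootSums k) : x.2 ∈ ℚ⟮ζ⟯ := by
  induction hx using rootSums_induction with
  | root z hz =>
    have : NeZero k := ⟨hk.ne'⟩
    obtain ⟨i, -, rfl⟩ := hζ.eq_pow_of_pow_eq_one hz
    exact pow_mem (mem_adjoin_simple_self ℚ ζ) i
  | zero => exact zero_mem _
  | add x y _ _ hx hy => exact add_mem hx hy

/-! ### Splitting off one prime -/

/-- Every root of unity of order dividing `p * k` is a power `θ ^ i`, `i < p`, times a `k`-th root
of unity. -/
def IsRootTransversal (θ : ℂ) (p k : ℕ) : Prop :=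
  ∀ z : ℂ, z ^ (p * k) = 1 → ∃ i : Fin p, ∃ w : ℂ, w ^ k = 1 ∧ z = θ ^ (i : ℕ) * w

theorem IsRootTransversal.exists_split {θ : ℂ} {p k : ℕ} (h : IsRootTransversal θ p k)
    {x : ℕ × ℂ} (hx : x ∈ rootSums (p * k)) :
    ∃ X : Fin p → ℕ × ℂ, (∀ i, X i ∈ rootSums k) ∧ x.1 = ∑ i, (X i).1 ∧
      x.2 = ∑ i : Fin p, θ ^ (i : ℕ) * (X i).2 := by
  induction hx using rootSums_induction with
  | root z hz =>
    obtain ⟨i, w, hw, rfl⟩ := h z hz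
    refine ⟨Pi.single i (1, w), fun j => ?_, ?_, ?_⟩
    · rcases eq_or_ne j i with rfl | hj
      · simpa using root_mem_rootSums hw
      · rw [Pi.single_eq_of_ne hj]; exact zero_mem _
    · rw [Finset.sum_eq_single i] <;> simp +contextual [Pi.single_eq_of_ne]
    · rw [Finset.sum_eq_single i] <;> simp +contextual [Pi.single_eq_of_ne]
  | zero => exact ⟨0, fun _ => zero_mem _, by simp, by simp⟩
  | add x y _ _ hx hy =>
    obtain ⟨X, hX, h1, h2⟩ := hx
    obtain ⟨Y, hY, h3, h4⟩ := hy
    exact ⟨X + Y, fun i => add_mem (hX i) (hY i), by simp [h1, h3, Finset.sum_add_distrib],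
      by simp [h2, h4, mul_add, Finset.sum_add_distrib]⟩

-- Since `φ(p * k) = p * φ(k)`, all `p` powers of a primitive `(p * k)`-th root are independent over
-- `ℚ(θ ^ p)`.
open IntermediateField in
theorem exists_transversal_of_dvd {p k : ℕ} (hp : p.Prime) (hk : 0 < k) (hpk : p ∣ k) :
    ∃ θ : ℂ, IsRootTransversal θ p k ∧ ∀ X Y : Fin p → ℕ × ℂ, (∀ i, X i ∈ rootSums k) →
      (∀ i, Y i ∈ rootSums k) →
      ∑ i : Fin p, θ ^ (i : ℕ) * (X i).2 = ∑ i : Fin p, θ ^ (i : ℕ) * (Y i).2 →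
      ∀ i, (X i).2 = (Y i).2 := by
  have hpos : 0 < p * k := Nat.mul_pos hp.pos hk
  have : NeZero (p * k) := ⟨hpos.ne'⟩
  obtain ⟨θ, hθ⟩ : ∃ θ : ℂ, IsPrimitiveRoot θ (p * k) :=
    ⟨_, Complex.isPrimitiveRoot_exp _ hpos.ne'⟩
  have hζ' : IsPrimitiveRoot (θ ^ p) k := hθ.pow hpos rfl
  refine ⟨θ, fun z hz => ?_, fun X Y hX hY h i => ?_⟩
  · obtain ⟨m, -, rfl⟩ := hθ.eq_pow_of_pow_eq_one hz
    refine ⟨⟨m % p, Nat.mod_lt _ hp.pos⟩, (θ ^ p) ^ (m / p), ?_, ?_⟩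
    · rw [← pow_mul, mul_comm, pow_mul, hζ'.pow_eq_one, one_pow]
    · rw [← pow_mul, ← pow_add, Nat.mod_add_div]
  · have hli := linearIndependent_pow_of_totient_le (d := p) hk hpos hζ' hθ
      (hθ.isIntegral hpos).tower_top (mem_adjoin_simple_self _ θ)
      (Nat.totient_mul_of_prime_of_dvd hp hpk).ge
    have hmem : ∀ i, (X i).2 - (Y i).2 ∈ ℚ⟮θ ^ p⟯ := fun i =>
      sub_mem (snd_mem_adjoin_of_mem_rootSums hk hζ' (hX i))
        (snd_mem_adjoin_of_mem_rootSums hk hζ' (hY i))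
    have h0 := Fintype.linearIndependent_iff.mp hli (fun i => ⟨_, hmem i⟩) (by
      simp only [IntermediateField.smul_def, smul_eq_mul, sub_mul, Finset.sum_sub_distrib]
      rw [sub_eq_zero]
      simpa only [mul_comm] using h) i
    exact sub_eq_zero.mp (congrArg Subtype.val h0)

-- Now `φ(p * k) = (p - 1) * φ(k)`, so the geometric sum is the only relation among the `p` powers
-- of `θ`, and the coefficient differences are all equal.
open IntermediateField in
theorem exists_transversal_of_not_dvd {p k : ℕ} (hp : p.Prime) (hk : 0 < k) (hpk : ¬p ∣ k) :
    ∃ θ : ℂ, IsRootTransversal θ p k ∧ ∀ X Y : Fin p → ℕ × ℂ, (∀ i, X i ∈ rootSums k) →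
      (∀ i, Y i ∈ rootSums k) →
      ∑ i : Fin p, θ ^ (i : ℕ) * (X i).2 = ∑ i : Fin p, θ ^ (i : ℕ) * (Y i).2 →
      ∀ i j, (X i).2 + (Y j).2 = (Y i).2 + (X j).2 := by
  have hpos : 0 < p * k := Nat.mul_pos hp.pos hk
  have : NeZero (p * k) := ⟨hpos.ne'⟩
  obtain ⟨θ, hθ⟩ : ∃ θ : ℂ, IsPrimitiveRoot θ p := ⟨_, Complex.isPrimitiveRoot_exp _ hp.ne_zero⟩
  obtain ⟨ζ', hζ'⟩ : ∃ ζ' : ℂ, IsPrimitiveRoot ζ' k := ⟨_, Complex.isPrimitiveRoot_exp _ hk.ne'⟩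
  have hζ : IsPrimitiveRoot (θ * ζ') (p * k) := by
    rw [IsPrimitiveRoot.iff_orderOf, hθ.eq_orderOf, hζ'.eq_orderOf]
    refine (Commute.all θ ζ').orderOf_mul_eq_mul_orderOf_of_coprime ?_
    rw [← hθ.eq_orderOf, ← hζ'.eq_orderOf]
    exact (Nat.Prime.coprime_iff_not_dvd hp).mpr hpk
  refine ⟨θ, fun z hz => ?_, fun X Y hX hY h => ?_⟩
  · obtain ⟨m, -, rfl⟩ := hζ.eq_pow_of_pow_eq_one hz
    refine ⟨⟨m % p, Nat.mod_lt _ hp.pos⟩, ζ' ^ m, ?_, ?_⟩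
    · rw [← pow_mul, mul_comm, pow_mul, hζ'.pow_eq_one, one_pow]
    · rw [mul_pow]
      congr 1
      conv_lhs => rw [← Nat.mod_add_div m p, pow_add, pow_mul, hθ.pow_eq_one, one_pow, mul_one]
  · obtain ⟨d, rfl⟩ : ∃ d, p = d + 1 := ⟨p - 1, (Nat.sub_add_cancel hp.pos).symm⟩
    have hmemθ : θ * ζ' ∈ ℚ⟮ζ'⟯⟮θ⟯ := mul_mem (mem_adjoin_simple_self _ θ)
      (IntermediateField.algebraMap_mem _ (⟨ζ', mem_adjoin_simple_self ℚ ζ'⟩ : ℚ⟮ζ'⟯))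
    have hli := linearIndependent_pow_of_totient_le (d := d) hk hpos hζ' hζ
      (hθ.isIntegral hp.pos).tower_top hmemθ (Nat.totient_mul_of_prime_of_not_dvd hp hpk).ge
    set c : Fin (d + 1) → ℂ := fun i => (X i).2 - (Y i).2 with hc
    have hmem : ∀ i, c i ∈ ℚ⟮ζ'⟯ := fun i =>
      sub_mem (snd_mem_adjoin_of_mem_rootSums hk hζ' (hX i))
        (snd_mem_adjoin_of_mem_rootSums hk hζ' (hY i))
    have hsum : ∑ i : Fin (d + 1), c i * θ ^ (i : ℕ) = 0 := by
      simp only [hc, sub_mul, Finset.sum_sub_distrib]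
      rw [sub_eq_zero]
      simpa only [mul_comm] using h
    have hgeom : ∑ i : Fin (d + 1), θ ^ (i : ℕ) = 0 := by
      rw [Fin.sum_univ_eq_sum_range (fun i => θ ^ i)]
      exact hθ.geom_sum_eq_zero hp.one_lt
    have hlast : ∀ i : Fin d, c i.castSucc = c (Fin.last d) := by
      intro i
      have h0 := Fintype.linearIndependent_iff.mp hli
        (fun i => ⟨_, sub_mem (hmem i.castSucc) (hmem (Fin.last d))⟩) (by
          simp only [IntermediateField.smul_def, smul_eq_mul, sub_mul, Finset.sum_sub_distrib]
          rw [Fin.sum_univ_castSucc] at hsum hgeom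
          simp only [Fin.val_castSucc, Fin.val_last] at hsum hgeom
          rw [← Finset.mul_sum]
          linear_combination hsum - c (Fin.last d) * hgeom) i
      exact sub_eq_zero.mp (congrArg Subtype.val h0)
    have hlast' : ∀ i, c i = c (Fin.last d) := fun i =>
      Fin.lastCases (motive := fun i => c i = c (Fin.last d)) rfl hlast i
    intro i j
    have := (hlast' i).trans (hlast' j).symm
    simp only [hc] at this
    linear_combination this

/-! ### The Lam–Leung theorem -/

/-- The additive monoid generated by the prime divisors of `k`. -/
def primeDivisorSpan (k : ℕ) : AddSubmonoid ℕ :=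
  AddSubmonoid.closure {p | p.Prime ∧ p ∣ k}

theorem primeDivisorSpan_mono {k l : ℕ} (h : k ∣ l) : primeDivisorSpan k ≤ primeDivisorSpan l :=
  AddSubmonoid.closure_mono fun _ hp => ⟨hp.1, hp.2.trans h⟩

theorem mem_primeFactorCombinations_of_mem_span {k n : ℕ} (hk : 0 < k)
    (hn : n ∈ primeDivisorSpan k) : n ∈ primeFactorCombinations k := by
  induction hn using AddSubmonoid.closure_induction with
  | mem p hp =>
    refine ⟨Pi.single p 1, ?_⟩
    rw [Finset.sum_eq_single p]
    · simp
    · intro q _ hq; simp [hq]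
    · intro h; exact absurd (Nat.mem_primeFactors.mpr ⟨hp.1, hp.2, hk.ne'⟩) h
  | zero => exact ⟨0, by simp⟩
  | add x y _ _ hx hy =>
    obtain ⟨c, rfl⟩ := hx
    obtain ⟨d, rfl⟩ := hy
    exact ⟨c + d, by simp [add_mul, Finset.sum_add_distrib]⟩

/-- By averaging over `p > m` indices, the least weight `q * A i + B i` is below `q`, which forces
`A i = 0` there. -/
theorem exists_fst_eq_zero_and_bound {p m q : ℕ} (hm : m < p) {A B : Fin p → ℕ}
    (h : q * ∑ i, A i + ∑ i, B i < m * q) :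
    ∃ i₀, A i₀ = 0 ∧ B i₀ < q ∧ ∀ i, B i₀ ≤ q * A i + B i := by
  obtain ⟨i₀, -, hmin⟩ := Finset.exists_min_image (Finset.univ : Finset (Fin p))
    (fun i => q * A i + B i) ⟨⟨0, by omega⟩, Finset.mem_univ _⟩
  have hlt : q * A i₀ + B i₀ < q := by
    by_contra! hge
    have : ∑ _i : Fin p, q ≤ ∑ i, (q * A i + B i) :=
      Finset.sum_le_sum fun i hi => hge.trans (hmin i hi)
    rw [Finset.sum_add_distrib, ← Finset.mul_sum] at this
    simp only [Finset.sum_const, Finset.card_univ, Fintype.card_fin, smul_eq_mul] at this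
    have := Nat.mul_le_mul_right q hm.le
    omega
  have hA : A i₀ = 0 := by
    by_contra hne
    have := Nat.le_mul_of_pos_right q (Nat.pos_of_ne_zero hne)
    omega
  refine ⟨i₀, hA, by omega, fun i => ?_⟩
  have := hmin i (Finset.mem_univ i)
  simp only [hA] at this
  omega

/-- Two equal sums of roots of unity whose lengths are small differ in length by a combination of
primes. -/
theorem exists_fst_eq_add_of_snd_eq {m q : ℕ} (hmq : m ≤ q) (k : ℕ) (hk : 0 < k)
    (hprimes : ∀ p, p.Prime → p ∣ k → p = m + 1 ∨ q < p) {x y : ℕ × ℂ} (hx : x ∈ rootSums k)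
    (hy : y ∈ rootSums k) (hxy : x.2 = y.2) (hlt : q * x.1 + y.1 < m * q) :
    ∃ s ∈ primeDivisorSpan k, y.1 = x.1 + s := by
  induction k using Nat.strong_induction_on generalizing x y with
  | _ k ih =>
  rcases eq_or_ne k 1 with rfl | hk1
  · refine ⟨0, zero_mem _, ?_⟩
    rw [snd_eq_fst_of_mem_rootSums_one hx, snd_eq_fst_of_mem_rootSums_one hy] at hxy
    simpa using (Nat.cast_injective hxy).symm
  -- The prime `m + 1` is taken only when no other is left: the bound for the inductive call needs
  -- `q ≤ p - 1`.
  obtain ⟨p, hp, ⟨l, rfl⟩, hpl⟩ : ∃ p, p.Prime ∧ p ∣ k ∧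
      (q < p ∨ p = m + 1 ∧ ∀ r, r.Prime → r ∣ k → r = p) := by
    by_cases h : ∃ p, p.Prime ∧ p ∣ k ∧ q < p
    · obtain ⟨p, hp, hpk, hq⟩ := h
      exact ⟨p, hp, hpk, Or.inl hq⟩
    · push Not at h
      have h' : ∀ r, r.Prime → r ∣ k → r = m + 1 := fun r hr hrk =>
        (hprimes r hr hrk).resolve_right (h r hr hrk).not_gt
      obtain ⟨p, hp, hpk⟩ := Nat.exists_prime_and_dvd hk1
      exact ⟨p, hp, hpk, Or.inr ⟨h' p hp hpk, fun r hr hrk =>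
        (h' r hr hrk).trans (h' p hp hpk).symm⟩⟩
  have hl : 0 < l := Nat.pos_of_mul_pos_left hk
  have hlk : l < p * l := lt_mul_of_one_lt_left hl hp.one_lt
  have hprimes' : ∀ r, r.Prime → r ∣ l → r = m + 1 ∨ q < r := fun r hr hrl =>
    hprimes r hr (hrl.mul_left p)
  have hmono : primeDivisorSpan l ≤ primeDivisorSpan (p * l) :=
    primeDivisorSpan_mono (dvd_mul_left l p)
  have hpmem : p ∈ primeDivisorSpan (p * l) := AddSubmonoid.subset_closure ⟨hp, dvd_mul_right p l⟩
  by_cases hdvd : p ∣ l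
  · obtain ⟨θ, htr, huniq⟩ := exists_transversal_of_dvd hp hl hdvd
    obtain ⟨X, hX, hX1, hX2⟩ := htr.exists_split hx
    obtain ⟨Y, hY, hY1, hY2⟩ := htr.exists_split hy
    have heq := huniq X Y hX hY (by rw [← hX2, ← hY2, hxy])
    have key : ∀ i, ∃ s ∈ primeDivisorSpan l, (Y i).1 = (X i).1 + s := by
      intro i
      refine ih l hlk hl hprimes' (hX i) (hY i) (heq i) (lt_of_le_of_lt ?_ hlt)
      rw [hX1, hY1]
      exact add_le_add (Nat.mul_le_mul_left q
        (Finset.single_le_sum (f := fun i => (X i).1) (fun _ _ => Nat.zero_le _)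
          (Finset.mem_univ i)))
        (Finset.single_le_sum (f := fun i => (Y i).1) (fun _ _ => Nat.zero_le _)
          (Finset.mem_univ i))
    choose s hs hsY using key
    refine ⟨∑ i, s i, sum_mem fun i _ => hmono (hs i), ?_⟩
    rw [hX1, hY1, ← Finset.sum_add_distrib]
    exact Finset.sum_congr rfl fun i _ => hsY i
  · obtain ⟨θ, htr, huniq⟩ := exists_transversal_of_not_dvd hp hl hdvd
    obtain ⟨X, hX, hX1, hX2⟩ := htr.exists_split hx
    obtain ⟨Y, hY, hY1, hY2⟩ := htr.exists_split hy
    have heq := huniq X Y hX hY (by rw [← hX2, ← hY2, hxy])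
    have hmp : m < p := by omega
    rw [hX1, hY1] at hlt
    obtain ⟨i₀, hXi, hYi, hle⟩ := exists_fst_eq_zero_and_bound hmp hlt
    -- The slice `X i₀` is empty, so the common difference of the slices is the value of `Y i₀`.
    have hval : ∀ j, (X j + Y i₀).2 = (Y j).2 := by
      intro j
      simpa [snd_eq_zero_of_mem_rootSums (hX i₀) hXi] using heq j i₀
    have key : ∀ j, ∃ s ∈ primeDivisorSpan l, (Y j).1 = (X j + Y i₀).1 + s := by
      intro j
      rcases hpl with hqp | ⟨-, hall⟩
      · refine ih l hlk hl hprimes' (add_mem (hX j) (hY i₀)) (hY j) (hval j)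
          (lt_of_le_of_lt ?_ hlt)
        -- The extra cost of adding `Y i₀` is paid by the other `p - 1 ≥ q` slices, each of weight
        -- at least `(Y i₀).1`.
        have h1 : q * (Y i₀).1 ≤ ∑ i ∈ Finset.univ.erase j, (q * (X i).1 + (Y i).1) := by
          calc q * (Y i₀).1 ≤ (Finset.univ.erase j).card * (Y i₀).1 := by
                refine Nat.mul_le_mul_right _ ?_
                rw [Finset.card_erase_of_mem (Finset.mem_univ j), Finset.card_univ,
                  Fintype.card_fin]
                omega
            _ ≤ _ := by
                rw [← smul_eq_mul]
                exact Finset.card_nsmul_le_sum _ _ _ fun i _ => hle i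
        rw [Finset.mul_sum, ← Finset.sum_add_distrib,
          ← Finset.add_sum_erase _ _ (Finset.mem_univ j), Prod.fst_add, mul_add]
        omega
      · have hl1 : l = 1 := by
          by_contra hne
          obtain ⟨r, hr, hrl⟩ := Nat.exists_prime_and_dvd hne
          exact hdvd (hall r hr (hrl.mul_left p) ▸ hrl)
        subst hl1
        refine ⟨0, zero_mem _, ?_⟩
        have := hval j
        rw [snd_eq_fst_of_mem_rootSums_one (add_mem (hX j) (hY i₀)),
          snd_eq_fst_of_mem_rootSums_one (hY j)] at this
        simpa using (Nat.cast_injective this).symm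
    choose s hs hsY using key
    -- `Y i₀` was added once to each of the `p` slices.
    refine ⟨(Y i₀).1 • p + ∑ i, s i,
      add_mem (nsmul_mem hpmem _) (sum_mem fun i _ => hmono (hs i)), ?_⟩
    rw [hX1, hY1, Finset.sum_congr rfl fun i _ => hsY i]
    simp only [Prod.fst_add, Finset.sum_add_distrib, Finset.sum_const, Finset.card_univ,
      Fintype.card_fin, smul_eq_mul]
    ring

/-- The **Lam–Leung theorem**: the length of a vanishing sum of `k`-th roots of unity is a
combination of the prime divisors of `k`. -/
theorem mem_primeDivisorSpan_of_mem_rootSums {k n : ℕ} (hk : 0 < k)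
    (h : ((n, 0) : ℕ × ℂ) ∈ rootSums k) : n ∈ primeDivisorSpan k := by
  rcases eq_or_ne k 1 with rfl | hk1
  · have := snd_eq_fst_of_mem_rootSums_one h
    have : n = 0 := by simpa using this.symm
    exact this ▸ zero_mem _
  have small : ∀ q, k.minFac - 1 ≤ q → n < (k.minFac - 1) * q →
      (∀ p, p.Prime → p ∣ k → p = k.minFac ∨ q < p) → n ∈ primeDivisorSpan k := by
    intro q hq hn hpr
    have hpos := k.minFac_pos
    obtain ⟨s, hs, hns⟩ := exists_fst_eq_add_of_snd_eq hq k hk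
      (by rwa [Nat.sub_add_cancel hpos]) (zero_mem _) h rfl (by simpa using hn)
    obtain rfl : n = s := by simpa using hns
    exact hs
  have hP := Nat.minFac_prime hk1
  have hP1 := hP.one_lt
  by_cases hex : ∃ p, p.Prime ∧ p ∣ k ∧ p ≠ k.minFac
  · classical
    have hQ := Nat.find_spec hex
    have hmin : ∀ p, p.Prime → p ∣ k → p ≠ k.minFac → Nat.find hex ≤ p :=
      fun p hp hpk hne => Nat.find_min' hex ⟨hp, hpk, hne⟩
    generalize Nat.find hex = Q at hQ hmin
    obtain ⟨hQp, hQk, hne⟩ := hQ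
    have hPQ : k.minFac ≤ Q := Nat.minFac_le_of_dvd hQp.two_le hQk
    have hQ1 := hQp.one_lt
    by_cases hn : n < (k.minFac - 1) * (Q - 1)
    · refine small (Q - 1) (by omega) hn fun p hp hpk => ?_
      rw [or_iff_not_imp_left]
      intro hpne
      have := hmin p hp hpk hpne
      omega
    · by_contra hnot
      -- The largest non-combination is `P * Q - P - Q = (P - 1) * (Q - 1) - 1`.
      have hfrob := frobeniusNumber_pair ((Nat.coprime_primes hP hQp).mpr hne.symm) hP1 hQ1
      have hsub : AddSubmonoid.closure {k.minFac, Q} ≤ primeDivisorSpan k := by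
        refine AddSubmonoid.closure_mono ?_
        rintro r (rfl | rfl)
        · exact ⟨hP, k.minFac_dvd⟩
        · exact ⟨hQp, hQk⟩
      have hle := hfrob.2 (show n ∈ {a | a ∉ AddSubmonoid.closure {k.minFac, Q}} from
        fun hmem => hnot (hsub hmem))
      apply hn
      obtain ⟨a, ha⟩ : ∃ a, k.minFac = a + 2 := ⟨k.minFac - 2, by omega⟩
      obtain ⟨b, rfl⟩ : ∃ b, Q = b + 2 := ⟨Q - 2, by omega⟩
      rw [ha] at hle ⊢
      have e1 : (a + 2) * (b + 2) = a * b + 2 * a + 2 * b + 4 := by ring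
      have e2 : (a + 2 - 1) * (b + 2 - 1) = a * b + a + b + 1 := by
        simp only [Nat.add_succ_sub_one]; ring
      omega
  · push Not at hex
    -- For a prime power, no second prime limits `q`, so it may exceed `n`.
    refine small (n + k.minFac) (by omega) ?_ fun p hp hpk => Or.inl (hex p hp hpk)
    exact lt_of_lt_of_le (by omega) (Nat.le_mul_of_pos_left _ (by omega : 0 < k.minFac - 1))

theorem mem_rootSums_of_mem_primeFactorCombinations {k n : ℕ}
    (hn : n ∈ primeFactorCombinations k) : ((n, 0) : ℕ × ℂ) ∈ rootSums k := by
  obtain ⟨c, rfl⟩ := hn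
  have : ∀ p ∈ k.primeFactors, ((c p * p, 0) : ℕ × ℂ) ∈ rootSums k := by
    intro p hp
    obtain ⟨hp, hpk, -⟩ := Nat.mem_primeFactors.mp hp
    have hζ := Complex.isPrimitiveRoot_exp p hp.ne_zero
    have hmem := sum_mem_rootSums (k := k) (Finset.range p)
      (fun i => Complex.exp (2 * Real.pi * Complex.I / p) ^ i)
      fun i _ => by
        obtain ⟨l, rfl⟩ := hpk
        rw [pow_right_comm, pow_mul, hζ.pow_eq_one, one_pow, one_pow]
    rw [hζ.geom_sum_eq_zero hp.one_lt, Finset.card_range] at hmem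
    simpa using nsmul_mem hmem (c p)
  convert sum_mem this using 1
  ext <;> simp [Prod.fst_sum, Prod.snd_sum]

theorem mem_weightSet_of_mem_rootSums {k n : ℕ} (hn : 0 < n)
    (h : ((n, 0) : ℕ × ℂ) ∈ rootSums k) : n ∈ weightSet k :=
  ⟨hn, exists_fin_of_mem_rootSums h⟩

/-! ### Commutators -/

theorem mem_rootSums_of_nonempty {k n : ℕ}
    (h : (commutatorPowOneSet k n).Nonempty) : ((n, 0) : ℕ × ℂ) ∈ rootSums k := by
  obtain ⟨⟨A, B⟩, hAB⟩ := h
  change (A * B - B * A) ^ k = 1 at hAB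
  set M := A * B - B * A with hM
  have htr : M.trace = 0 := by rw [hM, Matrix.trace_sub, Matrix.trace_mul_comm, sub_self]
  rw [Matrix.trace_eq_sum_roots_charpoly] at htr
  have hcard : M.charpoly.roots.card = n := by
    rw [← (IsAlgClosed.splits M.charpoly).natDegree_eq_card_roots,
      Matrix.charpoly_natDegree_eq_dim, Fintype.card_fin]
  have hroot : ∀ z ∈ M.charpoly.roots, z ^ k = 1 := by
    intro z hz
    have h1 := spectrum.pow_mem_pow M k
      (Matrix.mem_spectrum_iff_isRoot_charpoly.mpr (Polynomial.isRoot_of_mem_roots hz))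
    rw [hAB] at h1
    have : Nontrivial (Matrix (Fin n) (Fin n) ℂ) := by
      by_contra hnt
      rw [not_nontrivial_iff_subsingleton] at hnt
      simp [spectrum.of_subsingleton] at h1
    simpa [spectrum.one_eq] using h1
  have hgen : ∀ s : Multiset ℂ, (∀ z ∈ s, z ^ k = 1) →
      ((s.card, s.sum) : ℕ × ℂ) ∈ rootSums k := by
    intro s
    induction s using Multiset.induction_on with
    | empty => intro _; exact zero_mem _
    | cons z s ih =>
      intro hs
      have := add_mem (root_mem_rootSums (hs z (Multiset.mem_cons_self z s)))
        (ih fun w hw => hs w (Multiset.mem_cons_of_mem hw))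
      simpa [add_comm] using this
  simpa [hcard, htr] using hgen _ hroot

/-- A diagonal matrix of trace zero is a commutator. -/
theorem exists_commutator_eq_diagonal {R : Type*} [Ring R] {n : ℕ} (d : Fin n → R)
    (hd : ∑ i, d i = 0) :
    ∃ A B : Matrix (Fin n) (Fin n) R, A * B - B * A = Matrix.diagonal d := by
  obtain _ | n := n
  · exact ⟨0, 0, Subsingleton.elim _ _⟩
  -- Partial sums of `d`; the equation also holds at the wrap-around index because the total is
  -- zero.
  obtain ⟨s, hs⟩ : ∃ s : Fin (n + 1) → R, ∀ i, s (i + 1) - s i = d i := by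
    refine ⟨fun i => ∑ j ∈ Finset.Iio i, d j, fun i => ?_⟩
    refine Fin.lastCases ?_ (fun i => ?_) i
    · rw [← Finset.add_sum_erase _ _ (Finset.mem_univ (Fin.last n))] at hd
      have hset : Finset.univ.erase (Fin.last n) = Finset.Iio (Fin.last n) := by
        ext j; rw [Finset.mem_Iio, Fin.lt_last_iff_ne_last]
        simp only [Finset.mem_erase, Finset.mem_univ, and_true]
      have h0 : Finset.Iio (0 : Fin (n + 1)) = ∅ := by ext j; simp
      rw [hset] at hd
      simp only [Fin.last_add_one, h0, Finset.sum_empty, zero_sub]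
      exact (eq_neg_of_add_eq_zero_left hd).symm
    · have hset : Finset.Iio (i.castSucc + 1) = insert i.castSucc (Finset.Iio i.castSucc) := by
        ext j
        simp only [Fin.coeSucc_eq_succ, Finset.mem_Iio, Finset.mem_insert, Fin.lt_def, Fin.ext_iff,
          Fin.val_succ, Fin.val_castSucc]
        omega
      simp only [hset]
      rw [Finset.sum_insert (by simp), add_sub_cancel_right]
  -- A cyclic shift and a weighted reverse shift: the products are diagonal, with entries `s (i +
  -- 1)` and `s i`.
  refine ⟨Matrix.of fun i j => if j = i + 1 then 1 else 0,
    Matrix.of fun i j => if i = j + 1 then s i else 0, ?_⟩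
  ext i l
  simp only [Matrix.sub_apply, Matrix.mul_apply, Matrix.of_apply, ite_mul, one_mul, zero_mul,
    Finset.sum_ite_eq', Finset.mem_univ, if_true, mul_ite, mul_one, mul_zero, Matrix.diagonal_apply,
    add_left_inj]
  have : ∀ x : Fin (n + 1), (if l = x + 1 then if i = x + 1 then s i else 0 else 0) =
      if x = l - 1 then (if i = l then s i else 0) else 0 := by
    intro x
    by_cases hx : l = x + 1
    · subst hx; simp
    · rw [if_neg hx, if_neg (fun h => hx (by rw [h, sub_add_cancel]))]
  simp only [this, Finset.sum_ite_eq', Finset.mem_univ, if_true]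
  by_cases hil : i = l
  · simp [hil, ← hs]
  · simp [hil, Ne.symm hil]

theorem nonempty_of_mem_weightSet {k n : ℕ} (h : n ∈ weightSet k) :
    (commutatorPowOneSet k n).Nonempty := by
  obtain ⟨-, η, hη, hsum⟩ := h
  obtain ⟨A, B, hAB⟩ := exists_commutator_eq_diagonal η hsum
  refine ⟨(A, B), ?_⟩
  change (A * B - B * A) ^ k = 1
  rw [hAB, Matrix.diagonal_pow, ← Matrix.diagonal_one]
  exact congrArg Matrix.diagonal (funext hη)

theorem mainTheorem2 (k n : ℕ) (hk : 0 < k) (hn : 0 < n) :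
    ((commutatorPowOneSet k n).Nonempty ↔ n ∈ primeFactorCombinations k) ∧
      (n ∈ primeFactorCombinations k ↔ n ∈ weightSet k) := by
  have h1 : (commutatorPowOneSet k n).Nonempty → n ∈ primeFactorCombinations k := fun h =>
    mem_primeFactorCombinations_of_mem_span hk
      (mem_primeDivisorSpan_of_mem_rootSums hk (mem_rootSums_of_nonempty h))
  have h2 : n ∈ primeFactorCombinations k → n ∈ weightSet k := fun h =>
    mem_weightSet_of_mem_rootSums hn (mem_rootSums_of_mem_primeFactorCombinations h)
  exact ⟨⟨h1, fun h => nonempty_of_mem_weightSet (h2 h)⟩,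
    ⟨h2, fun h => h1 (nonempty_of_mem_weightSet h)⟩⟩
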